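/- Let $k$ be a commutative artinian ring, let $\check k$ be the minimal injective cogenerator of the category of finitely generated $k$-modules (the injective envelope of $k/\operatorname{rad}k$), and put $D=\operatorname{Hom}_k(-,\check k)$. Let $n\ge 1$ and let $(\mathcal C,\mathbb E,\mathfrak s)$ be a $k$-linear $n$-exangulated category (in the sense of Herschend–Liu–Nakaoka, with $\mathbb E:\mathcal C^{\mathrm{op}}\times\mathcal C\to k\text{-Mod}$ a $k$-bilinear bifunctor) which is Krull–Schmidt and Ext-finite, i.e. every $\mathbb E(X,Y)$ is a finitely generated $k$-module. A morphism $f:X\to Y$ is called $n$-projectively trivial if $\mathbb E(f,Z)=0$ for all $Z$, and $n$-injectively trivial if $\mathbb E(Z,f)=0$ for all $Z$. The stable category $\underline{\mathcal C}$ (the costable category $\overline{\mathcal C}$) has the objects of $\mathcal C$, and its morphisms are those of $\mathcal C$ modulo the $n$-projectively (respectively, $n$-injectively) trivial ones. Let $$\mathcal C_r=\{X\in\mathcal C \mid D\mathbb E(X,-):\overline{\mathcal C}\to k\text{-mod is representable}\},\qquad \mathcal C_l=\{Y\in\mathcal C\mid D\mathbb E(-,Y):\underline{\mathcal C}\to k\text{-mod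 is representable}\},$$ and let $\underline{\mathcal C_r}$ and $\overline{\mathcal C_l}$ be the full subcategories of $\underline{\mathcal C}$ and $\overline{\mathcal C}$ on the objects of $\mathcal C_r$ and $\mathcal C_l$, respectively. For every $X\in\mathcal C_r$ choose an object $\tau_nX$ and an isomorphism of functors $\phi_X:\overline{\mathcal C}(-,\tau_nX)\to D\mathbb E(X,-)$ on $\overline{\mathcal C}$; for every $Y\in\mathcal C_l$ choose an object $\tau_n^-Y$ and an isomorphism of functors $\psi_Y:\underline{\mathcal C}(\tau_n^-Y,-)\to D\mathbb E(-,Y)$ on $\underline{\mathcal C}$. Then, for all such choices, $\tau_nX\in\mathcal C_l$ for every $X\in\mathcal C_r$, and $\tau_n^-Y\in\mathcal C_r$ for every $Y\in\mathcal C_l$. For each $\underline f:X\to M$ in $\underline{\mathcal C_r}$ there is a unique morphism $\tau_n(\underline f):\tau_nX\to\tau_nM$ in $\overline{\mathcal C}$ with $\phi_M\circ\overline{\mathcal C}(-,\tau_n(\underline f))=D\mathbb E(f,-)\circ\phi_X$, and for each $\overline g:Y\to N$ in $\overline{\mathcal C_l}$ there is a unique morphism $\tau_n^-(\overline g):\tau_n^-Y\to\tau_n^-N$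 in $\underline{\mathcal C}$ with $\psi_Y\circ\underline{\mathcal C}(\tau_n^-(\overline g),-)=D\mathbb E(-,g)\circ\psi_N$. These assignments define functors $$\tau_n:\underline{\mathcal C_r}\to\overline{\mathcal C_l},\qquad \tau_n^-:\overline{\mathcal C_l}\to\underline{\mathcal C_r}.$$ Both functors are equivalences, and they are quasi-inverse to each other: $\tau_n^-\tau_n\cong\mathrm{Id}_{\underline{\mathcal C_r}}$ and $\tau_n\tau_n^-\cong\mathrm{Id}_{\overline{\mathcal C_l}}$. -/

import Mathlib

open CategoryTheory CategoryTheory.Limits Opposite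

universe v u

/-! ### Complexes with `n + 2` terms and prescribed end terms -/

section Complexes

variable {C : Type u} [Category.{v} C] [Preadditive C]

/-- A complex `X_0 ⟶ X_1 ⟶ ⋯ ⟶ X_{n+1}` in `C` (a complex concentrated in degrees `0, …, n+1`)
whose end terms `X_0` and `X_{n+1}` are identified with the given objects `A` and `B`. -/
structure EndedComplex (n : ℕ) (A B : C) where
  /-- the underlying complex -/
  cx : CochainComplex C ℕ
  isZero : ∀ i, n + 1 < i → IsZero (cx.X i)
  /-- the identification of the first term -/
  left : cx.X 0 ≅ A
  /-- the identification of the last term -/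
  right : cx.X (n + 1) ≅ B

namespace EndedComplex

variable {n : ℕ} {A B A' B' : C}

/-- The first differential, with source `A`. -/
def dFirst (X : EndedComplex n A B) : A ⟶ X.cx.X 1 := X.left.inv ≫ X.cx.d 0 1

/-- The last differential, with target `B`. -/
def dLast (X : EndedComplex n A B) : X.cx.X n ⟶ B := X.cx.d n (n + 1) ≫ X.right.hom

/-- The chain map `f` has the form `(a, f_1, …, f_n, b)`. -/
structure IsLift (X : EndedComplex n A B) (Y : EndedComplex n A' B') (a : A ⟶ A') (b : B ⟶ B')
    (f : X.cx ⟶ Y.cx) : Prop where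
  comm_left : f.f 0 ≫ Y.left.hom = X.left.hom ≫ a
  comm_right : f.f (n + 1) ≫ Y.right.hom = X.right.hom ≫ b

/-- Homotopy equivalence of complexes with fixed end terms: there are chain maps in both
directions, equal to the identities of `A` and `B` on the end terms, whose two composites are
homotopic to the identities. -/
def HtpyEquiv (X Y : EndedComplex n A B) : Prop :=
  ∃ e : HomotopyEquiv X.cx Y.cx, IsLift X Y (𝟙 A) (𝟙 B) e.hom ∧ IsLift Y X (𝟙 A) (𝟙 B) e.inv

/-- The setoid of homotopy equivalence with fixed end terms. -/
instance setoid (n : ℕ) (A B : C) : Setoid (EndedComplex n A B) where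
  r := HtpyEquiv
  iseqv :=
    { refl := fun X => ⟨HomotopyEquiv.refl _, ⟨by simp, by simp⟩, ⟨by simp, by simp⟩⟩
      symm := fun ⟨e, h, h'⟩ => ⟨e.symm, h', h⟩
      trans := by
        rintro X Y Z ⟨e, h, h'⟩ ⟨e₁, h₁, h₁'⟩
        obtain ⟨a, b⟩ := h
        obtain ⟨a', b'⟩ := h'
        obtain ⟨a₁, b₁⟩ := h₁
        obtain ⟨a₁', b₁'⟩ := h₁'
        simp only [Category.comp_id] at a b a' b' a₁ b₁ a₁' b₁'
        exact ⟨e.trans e₁, ⟨by simp [HomotopyEquiv.trans, *], by simp [HomotopyEquiv.trans, *]⟩,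
          ⟨by simp [HomotopyEquiv.trans, *], by simp [HomotopyEquiv.trans, *]⟩⟩ }

end EndedComplex

variable [HasBinaryBiproducts C]

/-- The data exhibiting `M` as the mapping cone
`X_1 ⟶ X_2 ⊞ Y_1 ⟶ ⋯ ⟶ X_{n+1} ⊞ Y_n ⟶ Y_{n+1}` of a chain map `f : X ⟶ Y`
(which is used when `f_0` is an identity). A matrix with columns `u, v` is `biprod.desc u v`,
one with rows `u, v` is `biprod.lift u v`. -/
structure MappingCone (n : ℕ) {X Y : CochainComplex C ℕ} (f : X ⟶ Y)
    (M : CochainComplex C ℕ) where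
  first : M.X 0 ≅ X.X 1
  mid : ∀ i, 1 ≤ i → i ≤ n → (M.X i ≅ X.X (i + 1) ⊞ Y.X i)
  last : M.X (n + 1) ≅ Y.X (n + 1)
  d_first : ∀ h : 1 ≤ n, M.d 0 1 ≫ (mid 1 le_rfl h).hom =
    first.hom ≫ biprod.lift (-X.d 1 2) (f.f 1)
  d_mid : ∀ (i : ℕ) (h : 1 ≤ i) (h' : i + 1 ≤ n),
    M.d i (i + 1) ≫ (mid (i + 1) (by omega) h').hom =
      (mid i h (by omega)).hom ≫
        biprod.desc (biprod.lift (-X.d (i + 1) (i + 2)) (f.f (i + 1)))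
          (biprod.lift 0 (Y.d i (i + 1)))
  d_last : ∀ h : 1 ≤ n, M.d n (n + 1) ≫ last.hom =
    (mid n h le_rfl).hom ≫ biprod.desc (f.f (n + 1)) (Y.d n (n + 1))

/-- The dual notion: the data exhibiting `M` as the mapping cocone
`X_0 ⟶ X_1 ⊞ Y_0 ⟶ ⋯ ⟶ X_n ⊞ Y_{n-1} ⟶ Y_n` of a chain map `f : X ⟶ Y`
(which is used when `f_{n+1}` is an identity). -/
structure MappingCocone (n : ℕ) {X Y : CochainComplex C ℕ} (f : X ⟶ Y)
    (M : CochainComplex C ℕ) where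
  first : M.X 0 ≅ X.X 0
  mid : ∀ i, 1 ≤ i → i ≤ n → (M.X i ≅ X.X i ⊞ Y.X (i - 1))
  last : M.X (n + 1) ≅ Y.X n
  d_first : ∀ h : 1 ≤ n, M.d 0 1 ≫ (mid 1 le_rfl h).hom =
    first.hom ≫ biprod.lift (X.d 0 1) (f.f 0)
  d_mid : ∀ (i : ℕ) (h : 1 ≤ i) (h' : i + 1 ≤ n),
    M.d i (i + 1) ≫ (mid (i + 1) (by omega) h').hom =
      (mid i h (by omega)).hom ≫
        biprod.desc (biprod.lift (X.d i (i + 1)) (f.f i)) (biprod.lift 0 (-Y.d (i - 1) i))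
  d_last : ∀ h : 1 ≤ n, M.d n (n + 1) ≫ last.hom =
    (mid n h le_rfl).hom ≫ biprod.desc (f.f n) (-Y.d (n - 1) n)

end Complexes

/-! ### `n`-exangulated categories -/

section Exangulated

variable {k : Type v} [CommRing k] {C : Type u} [Category.{v} C]

/-- The module `𝔼(B, A)` of extensions `A ⟶ ⋯ ⟶ B`. -/
abbrev ExtOf (E : Cᵒᵖ ⥤ C ⥤ ModuleCat.{v} k) (B A : C) : Type v := (E.obj (op B)).obj A

/-- `a_* δ = 𝔼(B, a)(δ)`. -/
abbrev pushExt (E : Cᵒᵖ ⥤ C ⥤ ModuleCat.{v} k) {B A A' : C} (a : A ⟶ A') :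
    ExtOf E B A →ₗ[k] ExtOf E B A' := ((E.obj (op B)).map a).hom

/-- `b^* δ = 𝔼(b, A)(δ)`. -/
abbrev pullExt (E : Cᵒᵖ ⥤ C ⥤ ModuleCat.{v} k) {B B' A : C} (b : B' ⟶ B) :
    ExtOf E B A →ₗ[k] ExtOf E B' A := ((E.map b.op).app A).hom

/-- The pair `⟨X, δ⟩` is an `n`-exangle: the sequences
`C(-, X_0) ⟶ ⋯ ⟶ C(-, X_{n+1}) ⟶ 𝔼(-, X_0)` and
`C(X_{n+1}, -) ⟶ ⋯ ⟶ C(X_0, -) ⟶ 𝔼(X_{n+1}, -)` are exact. -/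
structure IsExangle [Preadditive C] (E : Cᵒᵖ ⥤ C ⥤ ModuleCat.{v} k) {n : ℕ} {A B : C}
    (X : EndedComplex n A B) (δ : ExtOf E B A) : Prop where
  exact_cov : ∀ (T : C) (i : ℕ), i < n →
    Function.Exact (fun g : T ⟶ X.cx.X i => g ≫ X.cx.d i (i + 1))
      (fun g : T ⟶ X.cx.X (i + 1) => g ≫ X.cx.d (i + 1) (i + 2))
  exact_cov_last : ∀ T : C,
    Function.Exact (fun g : T ⟶ X.cx.X n => g ≫ X.dLast) (fun g : T ⟶ B => pullExt E g δ)
  exact_contra : ∀ (T : C) (i : ℕ), i < n →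
    Function.Exact (fun g : X.cx.X (i + 2) ⟶ T => X.cx.d (i + 1) (i + 2) ≫ g)
      (fun g : X.cx.X (i + 1) ⟶ T => X.cx.d i (i + 1) ≫ g)
  exact_contra_last : ∀ T : C,
    Function.Exact (fun g : X.cx.X 1 ⟶ T => X.dFirst ≫ g) (fun g : A ⟶ T => pushExt E g δ)

variable (k C) in
/-- A `k`-linear `n`-exangulated structure on the `k`-linear additive category `C`: a `k`-bilinear
bifunctor `𝔼`, and an exact realization `𝔰` of it which satisfies (EA1), (EA2), (EA2ᵒᵖ). -/
structure NExangulated [Preadditive C] [Linear k C] [HasBinaryBiproducts C] (n : ℕ) where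
  /-- the bifunctor `𝔼 : Cᵒᵖ × C ⥤ k-Mod` -/
  E : Cᵒᵖ ⥤ C ⥤ ModuleCat.{v} k
  push_add : ∀ {B A A' : C} (a a' : A ⟶ A') (δ : ExtOf E B A),
    pushExt E (a + a') δ = pushExt E a δ + pushExt E a' δ
  push_smul : ∀ {B A A' : C} (r : k) (a : A ⟶ A') (δ : ExtOf E B A),
    pushExt E (r • a) δ = r • pushExt E a δ
  pull_add : ∀ {B B' A : C} (b b' : B' ⟶ B) (δ : ExtOf E B A),
    pullExt E (b + b') δ = pullExt E b δ + pullExt E b' δ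
  pull_smul : ∀ {B B' A : C} (r : k) (b : B' ⟶ B) (δ : ExtOf E B A),
    pullExt E (r • b) δ = r • pullExt E b δ
  /-- the realization, which sends an extension to a homotopy equivalence class of complexes -/
  s : ∀ {A B : C}, ExtOf E B A → Quotient (EndedComplex.setoid n A B)
  /-- (R0): morphisms of extensions lift to the realizing complexes -/
  exists_lift : ∀ {A B A' B' : C} (δ : ExtOf E B A) (ρ : ExtOf E B' A')
    (X : EndedComplex n A B) (Y : EndedComplex n A' B'), s δ = ⟦X⟧ → s ρ = ⟦Y⟧ →
    ∀ (a : A ⟶ A') (b : B ⟶ B'), pushExt E a δ = pullExt E b ρ →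
      ∃ f : X.cx ⟶ Y.cx, X.IsLift Y a b f
  /-- (R1) -/
  isExangle : ∀ {A B : C} (δ : ExtOf E B A) (X : EndedComplex n A B), s δ = ⟦X⟧ →
    IsExangle E X δ
  /-- (R2): the zero extension in `𝔼(0, A)` is realized by `A = A ⟶ 0 ⟶ ⋯ ⟶ 0` -/
  zero_right : ∀ A Z : C, IsZero Z → ∃ X : EndedComplex n A Z,
    s (0 : ExtOf E Z A) = ⟦X⟧ ∧ IsIso (X.cx.d 0 1) ∧ ∀ i, 2 ≤ i → IsZero (X.cx.X i)
  /-- (R2), dual part: the zero extension in `𝔼(A, 0)` is realized by `0 ⟶ ⋯ ⟶ 0 ⟶ A = A` -/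
  zero_left : ∀ A Z : C, IsZero Z → ∃ X : EndedComplex n Z A,
    s (0 : ExtOf E A Z) = ⟦X⟧ ∧ IsIso (X.cx.d n (n + 1)) ∧ ∀ i, i < n → IsZero (X.cx.X i)
  /-- (EA1) for inflations; `f : A ⟶ B` is an inflation when it is the first differential
  of a complex which realizes some extension -/
  inflation_comp : ∀ {A B D : C} (f : A ⟶ B) (g : B ⟶ D),
    (∃ (Z : C) (δ : ExtOf E Z A) (X : EndedComplex n A Z) (e : X.cx.X 1 ≅ B),
      s δ = ⟦X⟧ ∧ X.dFirst ≫ e.hom = f) →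
    (∃ (Z : C) (δ : ExtOf E Z B) (X : EndedComplex n B Z) (e : X.cx.X 1 ≅ D),
      s δ = ⟦X⟧ ∧ X.dFirst ≫ e.hom = g) →
    ∃ (Z : C) (δ : ExtOf E Z A) (X : EndedComplex n A Z) (e : X.cx.X 1 ≅ D),
      s δ = ⟦X⟧ ∧ X.dFirst ≫ e.hom = f ≫ g
  /-- (EA1) for deflations -/
  deflation_comp : ∀ {A B D : C} (f : A ⟶ B) (g : B ⟶ D),
    (∃ (Z : C) (δ : ExtOf E B Z) (X : EndedComplex n Z B) (e : A ≅ X.cx.X n),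
      s δ = ⟦X⟧ ∧ e.hom ≫ X.dLast = f) →
    (∃ (Z : C) (δ : ExtOf E D Z) (X : EndedComplex n Z D) (e : B ≅ X.cx.X n),
      s δ = ⟦X⟧ ∧ e.hom ≫ X.dLast = g) →
    ∃ (Z : C) (δ : ExtOf E D Z) (X : EndedComplex n Z D) (e : A ≅ X.cx.X n),
      s δ = ⟦X⟧ ∧ e.hom ≫ X.dLast = f ≫ g
  /-- (EA2): `(id_A, b)` has a good lift, that is, one whose mapping cone `M` is such that
  `⟨M, (d_0^X)_* ρ⟩` is distinguished -/
  good_lift : ∀ {A B D : C} (ρ : ExtOf E D A) (b : B ⟶ D)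
    (X : EndedComplex n A B) (Y : EndedComplex n A D), s (pullExt E b ρ) = ⟦X⟧ → s ρ = ⟦Y⟧ →
    ∃ f : X.cx ⟶ Y.cx, X.IsLift Y (𝟙 A) b f ∧
      ∃ (M : EndedComplex n (X.cx.X 1) D) (c : MappingCone n f M.cx),
        M.left = c.first ∧ M.right = c.last ≪≫ Y.right ∧ s (pushExt E X.dFirst ρ) = ⟦M⟧
  /-- (EA2ᵒᵖ) -/
  good_lift_op : ∀ {A A' B : C} (ρ : ExtOf E B A) (a : A ⟶ A')
    (X : EndedComplex n A B) (Y : EndedComplex n A' B), s ρ = ⟦X⟧ → s (pushExt E a ρ) = ⟦Y⟧ →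
    ∃ f : X.cx ⟶ Y.cx, X.IsLift Y a (𝟙 B) f ∧
      ∃ (M : EndedComplex n A (Y.cx.X n)) (c : MappingCocone n f M.cx),
        M.left = c.first ≪≫ X.left ∧ M.right = c.last ∧ s (pullExt E Y.dLast ρ) = ⟦M⟧

end Exangulated

/-- `C` is a Krull–Schmidt category: every object is a finite direct sum of objects with local
endomorphism rings. -/
def IsKrullSchmidt (C : Type u) [Category.{v} C] [Preadditive C] : Prop :=
  ∀ X : C, ∃ (m : ℕ) (Y : Fin m → C) (b : Bicone Y),
    (∀ i, IsLocalRing (End (Y i))) ∧ Nonempty b.IsBilimit ∧ Nonempty (b.pt ≅ X)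

/-- `I` is a minimal injective cogenerator for the category of finitely generated modules over the
(artinian) commutative ring `k`: it is a finitely generated injective cogenerator, and it is
an injective envelope of `k / rad k`, the direct sum of one copy of each simple module. -/
structure IsMinimalInjectiveCogenerator (k : Type v) [CommRing k] (I : Type v) [AddCommGroup I]
    [Module k I] : Prop where
  finite : Module.Finite k I
  injective : Module.Injective k I
  cogenerator : ∀ (M : Type v) [AddCommGroup M] [Module k M] [Module.Finite k M] (m : M),
    m ≠ 0 → ∃ f : M →ₗ[k] I, f m ≠ 0
  minimal : ∃ ι : (k ⧸ Ring.jacobson k) →ₗ[k] I, Function.Injective ι ∧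
    ∀ N : Submodule k I, N ⊓ LinearMap.range ι = ⊥ → N = ⊥

/-- The contravariant functor `D = Hom_k(-, I)`. -/
def dualFunctor (k : Type v) [CommRing k] (I : Type v) [AddCommGroup I] [Module k I] :
    (ModuleCat.{v} k)ᵒᵖ ⥤ ModuleCat.{v} k where
  obj M := ModuleCat.of k (M.unop →ₗ[k] I)
  map f := ModuleCat.ofHom (LinearMap.lcomp k I f.unop.hom)

namespace NExangulated

variable {k : Type v} [CommRing k] {C : Type u} [Category.{v} C] [Preadditive C] [Linear k C]
  [HasBinaryBiproducts C] {n : ℕ} (S : NExangulated k C n)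

/-- All the modules `𝔼(B, A)` are finitely generated (equivalently, over an artinian ring,
of finite length). -/
def IsExtFinite : Prop := ∀ B A : C, Module.Finite k (ExtOf S.E B A)

/-! ### The stable and the costable category -/

/-- `f` is `n`-projectively trivial. -/
def IsProjTrivial {X Y : C} (f : X ⟶ Y) : Prop :=
  ∀ (Z : C) (δ : ExtOf S.E Y Z), pullExt S.E f δ = 0

/-- `g` is `n`-injectively trivial. -/
def IsInjTrivial {X Y : C} (g : X ⟶ Y) : Prop :=
  ∀ (Z : C) (δ : ExtOf S.E Z X), pushExt S.E g δ = 0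

/-- Congruence modulo the `n`-projectively trivial morphisms. -/
def projRel : HomRel C := fun _ _ f g => S.IsProjTrivial (f - g)

/-- Congruence modulo the `n`-injectively trivial morphisms. -/
def injRel : HomRel C := fun _ _ f g => S.IsInjTrivial (f - g)

lemma pull_sub {B B' A : C} (b b' : B' ⟶ B) (δ : ExtOf S.E B A) :
    pullExt S.E (b - b') δ = pullExt S.E b δ - pullExt S.E b' δ := by
  rw [eq_sub_iff_add_eq, ← S.pull_add, sub_add_cancel]

lemma push_sub {B A A' : C} (a a' : A ⟶ A') (δ : ExtOf S.E B A) :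
    pushExt S.E (a - a') δ = pushExt S.E a δ - pushExt S.E a' δ := by
  rw [eq_sub_iff_add_eq, ← S.push_add, sub_add_cancel]

lemma projRel_iff {X Y : C} (f g : X ⟶ Y) : S.projRel f g ↔
    ∀ (Z : C) (δ : ExtOf S.E Y Z), pullExt S.E f δ = pullExt S.E g δ := by
  simp only [projRel, IsProjTrivial, pull_sub, sub_eq_zero]

lemma injRel_iff {X Y : C} (f g : X ⟶ Y) : S.injRel f g ↔
    ∀ (Z : C) (δ : ExtOf S.E Z X), pushExt S.E f δ = pushExt S.E g δ := by
  simp only [injRel, IsInjTrivial, push_sub, sub_eq_zero]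

lemma pull_id {B A : C} (δ : ExtOf S.E B A) : pullExt S.E (𝟙 B) δ = δ := by
  simp only [pullExt, op_id, CategoryTheory.Functor.map_id]
  rfl

lemma pull_comp {B B' B'' A : C} (f : B'' ⟶ B') (g : B' ⟶ B) (δ : ExtOf S.E B A) :
    pullExt S.E (f ≫ g) δ = pullExt S.E f (pullExt S.E g δ) := by
  simp [pullExt]

lemma push_comp {B A A' A'' : C} (f : A ⟶ A') (g : A' ⟶ A'') (δ : ExtOf S.E B A) :
    pushExt S.E (f ≫ g) δ = pushExt S.E g (pushExt S.E f δ) := by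
  simp [pushExt]

instance : Congruence S.projRel where
  comp_left f g g' h := by
    rw [projRel_iff] at h ⊢
    intro Z δ
    rw [pull_comp, pull_comp, h]
  comp_right g h := by
    rw [projRel_iff] at h ⊢
    intro Z δ
    rw [pull_comp, pull_comp, h]
  equivalence :=
    { refl := fun f => by simp [projRel_iff]
      symm := fun h => by
        rw [projRel_iff] at h ⊢
        exact fun Z δ => (h Z δ).symm
      trans := fun h h' => by
        rw [projRel_iff] at h h' ⊢
        exact fun Z δ => (h Z δ).trans (h' Z δ) }

instance : Congruence S.injRel where
  comp_left f g g' h := by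
    rw [injRel_iff] at h ⊢
    intro Z δ
    rw [push_comp, push_comp, h]
  comp_right g h := by
    rw [injRel_iff] at h ⊢
    intro Z δ
    rw [push_comp, push_comp, h]
  equivalence :=
    { refl := fun f => by simp [injRel_iff]
      symm := fun h => by
        rw [injRel_iff] at h ⊢
        exact fun Z δ => (h Z δ).symm
      trans := fun h h' => by
        rw [injRel_iff] at h h' ⊢
        exact fun Z δ => (h Z δ).trans (h' Z δ) }

/-- The stable category of `C`: morphisms modulo the `n`-projectively trivial ones. -/
abbrev Stable := CategoryTheory.Quotient S.projRel

/-- The costable category of `C`: morphisms modulo the `n`-injectively trivial ones. -/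
abbrev Costable := CategoryTheory.Quotient S.injRel

instance : Preadditive S.Stable := CategoryTheory.Quotient.preadditive S.projRel (by
  intro X Y f₁ f₂ g₁ g₂ h h'
  rw [projRel_iff] at h h' ⊢
  intro Z δ
  rw [S.pull_add, S.pull_add, h, h'])

instance : Preadditive S.Costable := CategoryTheory.Quotient.preadditive S.injRel (by
  intro X Y f₁ f₂ g₁ g₂ h h'
  rw [injRel_iff] at h h' ⊢
  intro Z δ
  rw [S.push_add, S.push_add, h, h'])

instance : (CategoryTheory.Quotient.functor S.projRel).Additive where
  map_add := rfl

instance : (CategoryTheory.Quotient.functor S.injRel).Additive where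
  map_add := rfl

instance : Linear k S.Stable := CategoryTheory.Quotient.linear k S.projRel (by
  intro a X Y f g h
  rw [projRel_iff] at h ⊢
  intro Z δ
  rw [S.pull_smul, S.pull_smul, h])

instance : Linear k S.Costable := CategoryTheory.Quotient.linear k S.injRel (by
  intro a X Y f g h
  rw [injRel_iff] at h ⊢
  intro Z δ
  rw [S.push_smul, S.push_smul, h])

/-! ### The functor `D𝔼(-, -)` and the two subcategories -/

/-- The covariant functor `𝔼(X, -)` on the costable category. -/
def extCov (X : C) : S.Costable ⥤ ModuleCat.{v} k :=
  CategoryTheory.Quotient.lift S.injRel (S.E.obj (op X)) (by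
    intro A A' f g h
    rw [injRel_iff] at h
    ext δ
    exact h X δ)

/-- `𝔼(f, -) : 𝔼(Y, -) ⟶ 𝔼(X, -)`, as a natural transformation on the costable category. -/
def extCovMap {X Y : C} (f : X ⟶ Y) : S.extCov Y ⟶ S.extCov X :=
  CategoryTheory.Quotient.natTransLift S.injRel
    { app := fun A => (S.E.map f.op).app A
      naturality := fun _ _ a => (S.E.map f.op).naturality a }

variable (I : Type v) [AddCommGroup I] [Module k I]

/-- The bifunctor `(X, Y) ↦ D𝔼(X, Y)`, covariant in `X` in the stable category and contravariant
in `Y` in the costable category. -/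
def DE : S.Stable ⥤ S.Costableᵒᵖ ⥤ ModuleCat.{v} k :=
  CategoryTheory.Quotient.lift S.projRel
    { obj := fun X => (S.extCov X).op ⋙ dualFunctor k I
      map := fun f => Functor.whiskerRight (NatTrans.op (S.extCovMap f)) (dualFunctor k I)
      map_id := fun X => by
        ext A φ
        apply LinearMap.ext
        intro δ
        exact congrArg (show ExtOf S.E X A.unop.as →ₗ[k] I from φ) (S.pull_id δ)
      map_comp := fun {X _ _} f g => by
        ext A φ
        apply LinearMap.ext
        intro δ
        exact congrArg (show ExtOf S.E X A.unop.as →ₗ[k] I from φ) (S.pull_comp f g δ) }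
    (by
      intro X Y f g h
      rw [projRel_iff] at h
      ext A φ
      apply LinearMap.ext
      intro δ
      exact congrArg (show ExtOf S.E X A.unop.as →ₗ[k] I from φ) (h _ δ))

/-- The objects of `C_r` (as objects of the stable category): those `X` for which the functor
`D𝔼(X, -)` on the costable category is representable. -/
def Cr : ObjectProperty S.Stable := fun X =>
  ∃ T : S.Costable, Nonempty ((linearYoneda k S.Costable).obj T ≅ (S.DE I).obj X)

/-- The objects of `C_l` (as objects of the costable category): those `Y` for which the functor
`D𝔼(-, Y)` on the stable category is representable. -/
def Cl : ObjectProperty S.Costable := fun Y =>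
  ∃ T : S.Stable, Nonempty ((linearCoyoneda k S.Stable).obj (op T) ≅ (S.DE I).flip.obj (op Y))

/-! ### The functors `τ_n` and `τ_n^-` -/

/-- A choice, for every `X` in `C_r`, of an object `τ_n X` and of an isomorphism of functors
`φ_X : C̄(-, τ_n X) ≅ D𝔼(X, -)`. -/
structure TauChoice where
  obj : (S.Cr I).FullSubcategory → S.Costable
  φ : ∀ X, (linearYoneda k S.Costable).obj (obj X) ≅ (S.DE I).obj X.obj

/-- A choice, for every `Y` in `C_l`, of an object `τ_n^- Y` and of an isomorphism of functors
`ψ_Y : C̲(τ_n^- Y, -) ≅ D𝔼(-, Y)`. -/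
structure TauInvChoice where
  obj : (S.Cl I).FullSubcategory → S.Stable
  ψ : ∀ Y, (linearCoyoneda k S.Stable).obj (op (obj Y)) ≅ (S.DE I).flip.obj (op Y.obj)

instance : Nonempty (S.TauChoice I) :=
  ⟨{ obj := fun X => X.property.choose, φ := fun X => X.property.choose_spec.some }⟩

instance : Nonempty (S.TauInvChoice I) :=
  ⟨{ obj := fun X => X.property.choose, ψ := fun X => X.property.choose_spec.some }⟩

variable {S I}

/-- The square which defines `g = τ_n(f)`. -/
def TauChoice.IsTauMap (t : S.TauChoice I) {X M : (S.Cr I).FullSubcategory} (f : X ⟶ M)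
    (g : t.obj X ⟶ t.obj M) : Prop :=
  (linearYoneda k S.Costable).map g ≫ (t.φ M).hom = (t.φ X).hom ≫ (S.DE I).map f.hom

/-- The square which defines `h = τ_n^-(g)`. -/
def TauInvChoice.IsTauInvMap (t : S.TauInvChoice I) {Y N : (S.Cl I).FullSubcategory} (g : Y ⟶ N)
    (h : t.obj Y ⟶ t.obj N) : Prop :=
  (linearCoyoneda k S.Stable).map h.op ≫ (t.ψ Y).hom =
    (t.ψ N).hom ≫ (S.DE I).flip.map g.hom.op

lemma TauChoice.existsUnique_map (t : S.TauChoice I) {X M : (S.Cr I).FullSubcategory} (f : X ⟶ M) :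
    ∃! g, t.IsTauMap f g := by
  refine ⟨(linearYoneda k S.Costable).preimage ((t.φ X).hom ≫ (S.DE I).map f.hom ≫ (t.φ M).inv),
    by simp [IsTauMap], fun g hg => (linearYoneda k S.Costable).map_injective ?_⟩
  rw [Functor.map_preimage, ← Category.assoc, Iso.eq_comp_inv]
  exact hg

lemma TauInvChoice.existsUnique_map (t : S.TauInvChoice I) {Y N : (S.Cl I).FullSubcategory}
    (g : Y ⟶ N) : ∃! h, t.IsTauInvMap g h := by
  refine ⟨((linearCoyoneda k S.Stable).preimage
    ((t.ψ N).hom ≫ (S.DE I).flip.map g.hom.op ≫ (t.ψ Y).inv)).unop,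
    by simp [IsTauInvMap], fun h hh => Quiver.Hom.op_inj
      ((linearCoyoneda k S.Stable).map_injective ?_)⟩
  rw [Quiver.Hom.op_unop, Functor.map_preimage, ← Category.assoc, Iso.eq_comp_inv]
  exact hh

/-- The functor `τ_n` from the stable category of `C_r` to the costable category of `C` attached
to a choice of representing objects. -/
noncomputable def TauChoice.functor (t : S.TauChoice I) :
    (S.Cr I).FullSubcategory ⥤ S.Costable where
  obj := t.obj
  map f := (t.existsUnique_map f).choose
  map_id X := ((t.existsUnique_map (𝟙 X)).choose_spec.2 _ (by simp [IsTauMap])).symm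
  map_comp {X M N} f g := ((t.existsUnique_map (f ≫ g)).choose_spec.2 _ (by
    have hf := (t.existsUnique_map f).choose_spec.1
    have hg := (t.existsUnique_map g).choose_spec.1
    simp only [IsTauMap] at hf hg ⊢
    rw [Functor.map_comp, Category.assoc, hg, reassoc_of% hf]
    simp)).symm

/-- The functor `τ_n^-` from the costable category of `C_l` to the stable category of `C` attached
to a choice of representing objects. -/
noncomputable def TauInvChoice.functor (t : S.TauInvChoice I) :
    (S.Cl I).FullSubcategory ⥤ S.Stable where
  obj := t.obj
  map f := (t.existsUnique_map f).choose
  map_id X := ((t.existsUnique_map (𝟙 X)).choose_spec.2 _ (by simp [IsTauInvMap])).symm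
  map_comp {X M N} f g := ((t.existsUnique_map (f ≫ g)).choose_spec.2 _ (by
    have hf := (t.existsUnique_map f).choose_spec.1
    have hg := (t.existsUnique_map g).choose_spec.1
    simp only [IsTauInvMap] at hf hg ⊢
    rw [op_comp, Functor.map_comp, Category.assoc, hf, reassoc_of% hg]
    simp)).symm

end NExangulated

/-! ### Matlis duality over a commutative artinian ring -/

section Duality

/-! By Yoneda, a representation of `D𝔼(X, -)` by `T` is a linear form `η` on `𝔼(X, T)` for which `g
↦ η(g_* -)` identifies `C̄(Z, T)` with `D𝔼(X, Z)` for all `Z`. A representation of `D𝔼(-, T)` by `X`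
is a form on the same module for which `f ↦ η(f^* -)` identifies `C̲(X, Z)` with `D𝔼(Z, T)`. The
heart of the proof is that these two conditions on `η` are equivalent
(`RepresentsCov.representsContra`, `RepresentsContra.representsCov`). Moreover the squares defining
`τ_n` and `τ_n^-` both unwind to the one equation `η(f^* -) = ζ(g_* -)` (`Compatible`), so
uniqueness of representing objects yields the two natural isomorphisms.

The equivalence of the conditions has two inputs. One is exactness at `𝔼(T, A)` of the long sequence
of an `n`-exangle, and its dual, deduced from good lifts (`exists_pull_eq`, `exists_push_eq`). The
other is duality for modules of finite length: a submodule of `DM` separating the points of `M` is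
all of `DM` (`eq_top_of_separating`). Minimality of `I` enters only there, through the bound `length
DM ≤ length M`. -/

/-- If `x` were in `p`, then `x ^ 2 ∈ J` and so `x ∈ J`. Hence `r * x + i = 1` with `i ∈ p`, and `i
* y ∈ J`. In other words, the `p`-torsion of `R ⧸ J` is at most one-dimensional over `R ⧸ p`. -/
lemma Ideal.IsRadical.exists_mul_sub_mem {R : Type*} [CommRing R] {J p : Ideal R}
    (hJ : J.IsRadical) [hp : p.IsMaximal] {x y : R} (hx : x ∉ J) (hxp : ∀ a ∈ p, a * x ∈ J)
    (hyp : ∀ a ∈ p, a * y ∈ J) : ∃ a : R, a * x - y ∈ J := by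
  have hx' : x ∉ p := fun h => hx (hJ ⟨2, by simpa [pow_two] using hxp x h⟩)
  obtain ⟨r, i, hi, hr⟩ := hp.exists_inv hx'
  refine ⟨r * y, ?_⟩
  rw [show r * y * x - y = -(i * y) by linear_combination y * hr]
  exact J.neg_mem (hyp i hi)

lemma Ring.isRadical_jacobson (R : Type*) [CommRing R] : (Ring.jacobson R).IsRadical := by
  rintro x ⟨m, hm⟩
  rw [Ring.jacobson_eq_sInf_isMaximal, Ideal.mem_sInf] at hm ⊢
  exact fun {J} hJ => (Ideal.IsMaximal.isPrime hJ).mem_of_pow_mem m (hm hJ)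

variable {k : Type v} [CommRing k] {I : Type v} [AddCommGroup I] [Module k I]

namespace IsMinimalInjectiveCogenerator

/-- The `p`-torsion of `I` lies inside the essential copy of `k / rad k`, where it is at most
one-dimensional because `rad k` is a radical ideal. -/
lemma exists_smul_eq_of_isMaximal (hI : IsMinimalInjectiveCogenerator k I) {p : Ideal k}
    [hp : p.IsMaximal] {x y : I} (hx : x ≠ 0) (hxp : ∀ a ∈ p, a • x = 0)
    (hyp : ∀ a ∈ p, a • y = 0) : ∃ a : k, a • x = y := by
  obtain ⟨ι, hι, hess⟩ := hI.minimal
  -- A nonzero `z` killed by `p` spans a simple module, which must meet the essential submodule; any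
  -- nonzero multiple `r • z` has `r ∉ p`, so `z` is in turn a multiple of it.
  have key : ∀ z : I, (∀ a ∈ p, a • z = 0) → z ∈ LinearMap.range ι := by
    intro z hz
    by_cases hz0 : z = 0
    · rw [hz0]
      exact zero_mem _
    · have h1 : Submodule.span k {z} ⊓ LinearMap.range ι ≠ ⊥ := fun h => hz0 (by
        simpa using hess _ h)
      obtain ⟨w, ⟨hw, hw'⟩, hw0⟩ := Submodule.exists_mem_ne_zero_of_ne_bot h1
      obtain ⟨r, rfl⟩ := Submodule.mem_span_singleton.mp hw
      have hr : r ∉ p := fun h => hw0 (hz r h)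
      obtain ⟨s, i, hi, hs⟩ := hp.exists_inv hr
      have : z = s • r • z := by
        conv_lhs => rw [← one_smul k z, ← hs, add_smul, hz i hi, add_zero, mul_smul]
      rw [this]
      exact Submodule.smul_mem _ _ hw'
  obtain ⟨x', rfl⟩ := key x hxp
  obtain ⟨y', rfl⟩ := key y hyp
  obtain ⟨x₁, rfl⟩ := Submodule.mkQ_surjective _ x'
  obtain ⟨y₁, rfl⟩ := Submodule.mkQ_surjective _ y'
  have hmem : ∀ z : k, ι ((Ring.jacobson k).mkQ z) = 0 ↔ z ∈ Ring.jacobson k := fun z => by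
    rw [map_eq_zero_iff ι hι, Submodule.mkQ_apply, Submodule.Quotient.mk_eq_zero]
  obtain ⟨a, ha⟩ := (Ring.isRadical_jacobson k).exists_mul_sub_mem (p := p)
    (fun h => hx ((hmem _).mpr h))
    (fun a h => (hmem _).mp (by rw [← smul_eq_mul, map_smul, map_smul, hxp a h]))
    (fun a h => (hmem _).mp (by rw [← smul_eq_mul, map_smul, map_smul, hyp a h]))
  refine ⟨a, ?_⟩
  rw [← sub_eq_zero, ← map_smul, ← map_smul, ← map_sub, ← map_sub]
  exact (hmem _).mpr ha

variable [IsArtinianRing k]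

/-- Dévissage along a filtration with factors `k / p`, where `p` is maximal. A form on `k / p` is
determined by the image of `1`, a `p`-torsion element of `I`, so the dual is zero or simple. An
inequality suffices, so extensions need only left exactness of `D`. -/
lemma length_dual_le (hI : IsMinimalInjectiveCogenerator k I) (M : Type v) [AddCommGroup M]
    [Module k M] [hM : Module.Finite k M] : Module.length k (M →ₗ[k] I) ≤ Module.length k M := by
  induction hM using IsNoetherianRing.induction_on_isQuotientEquivQuotientPrime with
  | subsingleton N => simp [Module.length_eq_zero]
  | quotient N p e =>
    have hp : p.1.IsMaximal := inferInstance
    have hann : ∀ (f : N →ₗ[k] I), ∀ a ∈ p.1, a • f (e.symm 1) = 0 := by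
      intro f a ha
      rw [← map_smul, ← map_smul]
      have : a • (1 : k ⧸ p.1) = 0 := by
        rw [Algebra.smul_def, mul_one]
        exact Ideal.Quotient.eq_zero_iff_mem.mpr ha
      rw [this, map_zero, map_zero]
    have hext : ∀ f g : N →ₗ[k] I, f (e.symm 1) = g (e.symm 1) → f = g := by
      intro f g h
      ext z
      obtain ⟨z, rfl⟩ := e.symm.surjective z
      obtain ⟨r, rfl⟩ := Ideal.Quotient.mk_surjective z
      have : (Ideal.Quotient.mk p.1 r) = r • (1 : k ⧸ p.1) := by
        rw [Algebra.smul_def, mul_one]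
        rfl
      rw [this, map_smul, map_smul, map_smul, h]
    rcases subsingleton_or_nontrivial (N →ₗ[k] I) with h | h
    · simp [Module.length_eq_zero]
    · have : IsSimpleModule k (N →ₗ[k] I) := by
        refine isSimpleModule_iff_toSpanSingleton_surjective.mpr ⟨h, fun f hf g => ?_⟩
        obtain ⟨a, ha⟩ := hI.exists_smul_eq_of_isMaximal (p := p.1)
          (fun h0 => hf (hext f 0 (by simpa using h0))) (hann f) (hann g)
        exact ⟨a, hext _ _ (by simpa using ha)⟩
      rw [Module.length_eq_one, e.length_eq, Order.one_le_iff_ne_zero, Ne,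
        Module.length_eq_zero_iff, not_subsingleton_iff_nontrivial]
      infer_instance
  | exact N₁ N₂ N₃ f g hf hg hfg h₁ h₃ =>
    rw [Module.length_eq_add_of_exact f g hf hg hfg]
    have hker : Function.Exact (LinearMap.lcomp k I g) (LinearMap.lcomp k I f) :=
      LinearMap.exact_lcomp_of_exact_of_surjective I hfg hg
    rw [Module.length_eq_add_of_exact (LinearMap.ker (LinearMap.lcomp k I f)).subtype
      (LinearMap.lcomp k I f).rangeRestrict (Submodule.subtype_injective _)
      (LinearMap.surjective_rangeRestrict _) (by
        rw [LinearMap.exact_iff, LinearMap.ker_rangeRestrict, Submodule.range_subtype])]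
    -- The range of restriction embeds in the dual of `N₁`, and its kernel is an image of the dual
    -- of `N₃`.
    rw [add_comm]
    refine add_le_add ((Module.length_le_of_injective _
      (Submodule.subtype_injective _)).trans h₁) (le_trans ?_ h₃)
    rw [LinearMap.exact_iff.mp hker]
    exact Module.length_le_of_surjective _ (LinearMap.surjective_rangeRestrict _)

/-- A submodule of the dual of `M` which separates the points of `M` is the whole dual. -/
lemma eq_top_of_separating (hI : IsMinimalInjectiveCogenerator k I) {M : Type v} [AddCommGroup M]
    [Module k M] [Module.Finite k M] (N : Submodule k (M →ₗ[k] I))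
    (hN : ∀ m : M, (∀ φ ∈ N, φ m = 0) → m = 0) : N = ⊤ := by
  have hfin : IsFiniteLength k (M →ₗ[k] I) := Module.length_ne_top_iff.mp
    (ne_top_of_le_ne_top Module.length_ne_top (hI.length_dual_le M))
  obtain ⟨_, _⟩ := isFiniteLength_iff_isNoetherian_isArtinian.mp hfin
  -- For proper `N`, `length N < length DM ≤ length M ≤ length DN ≤ length N`. The first inequality
  -- is strict because `DM` has finite length; the third holds because evaluation embeds `M` in `DN`
  -- when `N` separates points.
  by_contra h
  have hlt := Submodule.length_lt h
  refine absurd (hlt.trans_le ((hI.length_dual_le M).trans ?_)) (lt_irrefl _)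
  refine le_trans ?_ (hI.length_dual_le N)
  refine Module.length_le_of_injective ((LinearMap.lcomp k I N.subtype).comp
    (LinearMap.id (R := k) (M := M →ₗ[k] I)).flip) ?_
  rw [injective_iff_map_eq_zero]
  exact fun m hm => hN m fun φ hφ => LinearMap.congr_fun hm ⟨φ, hφ⟩

end IsMinimalInjectiveCogenerator
end Duality
/-! ### The long exact sequences of an `n`-exangle -/

namespace NExangulated

variable {k : Type v} [CommRing k] {C : Type u} [Category.{v} C] [Preadditive C] [Linear k C]
  [HasBinaryBiproducts C] {n : ℕ} (S : NExangulated k C n)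

lemma push_pull {B B' A A' : C} (a : A ⟶ A') (b : B' ⟶ B) (δ : ExtOf S.E B A) :
    pushExt S.E a (pullExt S.E b δ) = pullExt S.E b (pushExt S.E a δ) :=
  (ConcreteCategory.congr_hom ((S.E.map b.op).naturality a) δ).symm

lemma pull_zero {B B' A : C} (δ : ExtOf S.E B A) : pullExt S.E (0 : B' ⟶ B) δ = 0 := by
  simpa using S.pull_smul (0 : k) (0 : B' ⟶ B) δ

lemma push_zero {B A A' : C} (δ : ExtOf S.E B A) : pushExt S.E (0 : A ⟶ A') δ = 0 := by
  simpa using S.push_smul (0 : k) (0 : A ⟶ A') δ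

lemma push_id {B A : C} (δ : ExtOf S.E B A) : pushExt S.E (𝟙 A) δ = δ := by
  simp [pushExt]

lemma exists_realization {A B : C} (δ : ExtOf S.E B A) :
    ∃ X : EndedComplex n A B, S.s δ = ⟦X⟧ :=
  ⟨(S.s δ).out, (Quotient.out_eq _).symm⟩

lemma pull_dLast {A B : C} {δ : ExtOf S.E B A} {X : EndedComplex n A B} (h : S.s δ = ⟦X⟧) :
    pullExt S.E X.dLast δ = 0 :=
  ((S.isExangle δ X h).exact_cov_last _ _).mpr ⟨𝟙 _, by simp⟩

lemma push_dFirst {A B : C} {δ : ExtOf S.E B A} {X : EndedComplex n A B} (h : S.s δ = ⟦X⟧) :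
    pushExt S.E X.dFirst δ = 0 :=
  ((S.isExangle δ X h).exact_contra_last _ _).mpr ⟨𝟙 _, by simp⟩

/-- Exactness of `C(T, B) ⟶ 𝔼(T, A) ⟶ 𝔼(T, X_1)` for a distinguished `n`-exangle `⟨X, δ⟩`. -/
lemma exists_pull_eq (hn : 1 ≤ n) {A B T : C} {δ : ExtOf S.E B A} {X : EndedComplex n A B}
    (h : S.s δ = ⟦X⟧) (ε : ExtOf S.E T A) (hε : pushExt S.E X.dFirst ε = 0) :
    ∃ f : T ⟶ B, pullExt S.E f δ = ε := by
  -- `θ` restricts to `δ` on `B` and to `ε` on `T`. The cone of a good lift of `biprod.inl` then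
  -- realizes `(d_0)_* θ`, which is zero.
  let θ : ExtOf S.E (B ⊞ T) A := pullExt S.E biprod.fst δ + pullExt S.E biprod.snd ε
  have hθ₁ : pullExt S.E (biprod.inl : B ⟶ B ⊞ T) θ = δ := by
    simp only [θ, map_add]
    rw [← pull_comp, ← pull_comp, biprod.inl_fst, biprod.inl_snd, pull_id, pull_zero, add_zero]
  have hθ₂ : pullExt S.E (biprod.inr : T ⟶ B ⊞ T) θ = ε := by
    simp only [θ, map_add]
    rw [← pull_comp, ← pull_comp, biprod.inr_fst, biprod.inr_snd, pull_id, pull_zero, zero_add]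
  have hpush : pushExt S.E X.dFirst θ = 0 := by
    simp only [θ, map_add]
    rw [push_pull, push_pull, S.push_dFirst h, hε, map_zero, map_zero, add_zero]
  obtain ⟨Z, hZ⟩ := S.exists_realization θ
  obtain ⟨f, hf, M, c, -, hMr, hM⟩ := S.good_lift θ biprod.inl X Z (by rw [hθ₁, h]) hZ
  rw [hpush] at hM
  -- Every pullback of the zero extension is zero, so `biprod.inr` lifts through the last
  -- differential of the cone.
  obtain ⟨u, hu⟩ := ((S.isExangle _ M hM).exact_cov_last T biprod.inr).mp (map_zero _)
  have hd : M.dLast = (c.mid n hn le_rfl).hom ≫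
      biprod.desc (X.right.hom ≫ biprod.inl) Z.dLast := by
    rw [EndedComplex.dLast, hMr, Iso.trans_hom, reassoc_of% c.d_last hn, ← hf.comm_right]
    congr 1
    ext <;> simp [EndedComplex.dLast]
  refine ⟨u ≫ (c.mid n hn le_rfl).hom ≫ biprod.fst ≫ X.right.hom, ?_⟩
  simp only at hu
  rw [hd] at hu
  -- The first component of the lift is the required `f`. Pulling `θ` back along this identity gives
  -- `ε = f^* δ`, since `Z.dLast` annihilates `θ`.
  have hu' : (u ≫ (c.mid n hn le_rfl).hom ≫ biprod.fst ≫ X.right.hom) ≫ biprod.inl +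
      (u ≫ (c.mid n hn le_rfl).hom ≫ biprod.snd) ≫ Z.dLast = biprod.inr := by
    rw [← hu, biprod.desc_eq]
    simp
  rw [← hθ₂, ← hu', S.pull_add, S.pull_comp _ biprod.inl, hθ₁, S.pull_comp _ Z.dLast,
    S.pull_dLast hZ, map_zero, add_zero]

/-- Exactness of `C(A, T) ⟶ 𝔼(B, T) ⟶ 𝔼(X_n, T)` for a distinguished `n`-exangle `⟨X, δ⟩`. -/
lemma exists_push_eq (hn : 1 ≤ n) {A B T : C} {δ : ExtOf S.E B A} {X : EndedComplex n A B}
    (h : S.s δ = ⟦X⟧) (ε : ExtOf S.E B T) (hε : pullExt S.E X.dLast ε = 0) :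
    ∃ f : A ⟶ T, pushExt S.E f δ = ε := by
  -- Dually, `θ` has components `δ` and `ε`, and the cocone of a good lift of `biprod.fst` realizes
  -- the zero extension, so `biprod.snd` extends along its first differential.
  let θ : ExtOf S.E B (A ⊞ T) := pushExt S.E biprod.inl δ + pushExt S.E biprod.inr ε
  have hθ₁ : pushExt S.E (biprod.fst : A ⊞ T ⟶ A) θ = δ := by
    simp only [θ, map_add]
    rw [← push_comp, ← push_comp, biprod.inl_fst, biprod.inr_fst, push_id, push_zero, add_zero]
  have hθ₂ : pushExt S.E (biprod.snd : A ⊞ T ⟶ T) θ = ε := by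
    simp only [θ, map_add]
    rw [← push_comp, ← push_comp, biprod.inl_snd, biprod.inr_snd, push_id, push_zero, zero_add]
  have hpull : pullExt S.E X.dLast θ = 0 := by
    simp only [θ, map_add]
    rw [← push_pull, ← push_pull, S.pull_dLast h, hε, map_zero, map_zero, add_zero]
  obtain ⟨Z, hZ⟩ := S.exists_realization θ
  obtain ⟨f, hf, M, c, hMl, -, hM⟩ := S.good_lift_op θ biprod.fst Z X hZ (by rw [hθ₁, h])
  rw [hpull] at hM
  obtain ⟨u, hu⟩ := ((S.isExangle _ M hM).exact_contra_last T biprod.snd).mp (map_zero _)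
  have hd : M.dFirst ≫ (c.mid 1 le_rfl hn).hom =
      biprod.lift Z.dFirst (biprod.fst ≫ X.left.inv) := by
    have hl : Z.left.inv ≫ f.f 0 = biprod.fst ≫ X.left.inv := by
      rw [Iso.inv_comp_eq, ← Category.assoc, Iso.eq_comp_inv, hf.comm_left]
    rw [EndedComplex.dFirst, hMl, Category.assoc, c.d_first hn]
    ext <;> simp [EndedComplex.dFirst, hl]
  refine ⟨X.left.inv ≫ biprod.inr ≫ (c.mid 1 le_rfl hn).inv ≫ u, ?_⟩
  simp only at hu
  have hu' : Z.dFirst ≫ (biprod.inl ≫ (c.mid 1 le_rfl hn).inv ≫ u) +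
      biprod.fst ≫ (X.left.inv ≫ biprod.inr ≫ (c.mid 1 le_rfl hn).inv ≫ u) = biprod.snd := by
    rw [← hu, ← cancel_mono (𝟙 T)]
    rw [← Iso.eq_comp_inv] at hd
    rw [hd, biprod.lift_eq]
    simp
  rw [← hθ₂, ← hu', S.push_add, S.push_comp biprod.fst, hθ₁, S.push_comp Z.dFirst,
    S.push_dFirst hZ, map_zero, zero_add]

end NExangulated
/-! ### Auslander–Reiten forms -/

namespace NExangulated

variable {k : Type v} [CommRing k] {C : Type u} [Category.{v} C] [Preadditive C] [Linear k C]
  [HasBinaryBiproducts C] {n : ℕ} (S : NExangulated k C n)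
  {I : Type v} [AddCommGroup I] [Module k I]

/-- The form `η` on `𝔼(X, T)` induces bijections `C̄(Z, T) ≅ D𝔼(X, Z)`. -/
structure RepresentsCov {X T : C} (η : ExtOf S.E X T →ₗ[k] I) : Prop where
  surj : ∀ (Z : C) (F : ExtOf S.E X Z →ₗ[k] I), ∃ g : Z ⟶ T, η ∘ₗ pushExt S.E g = F
  inj : ∀ (Z : C) (g : Z ⟶ T), η ∘ₗ pushExt S.E g = 0 → S.IsInjTrivial g

/-- The form `η` on `𝔼(X, T)` induces bijections `C̲(X, Z) ≅ D𝔼(Z, T)`. -/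
structure RepresentsContra {X T : C} (η : ExtOf S.E X T →ₗ[k] I) : Prop where
  surj : ∀ (Z : C) (F : ExtOf S.E Z T →ₗ[k] I), ∃ f : X ⟶ Z, η ∘ₗ pullExt S.E f = F
  inj : ∀ (Z : C) (f : X ⟶ Z), η ∘ₗ pullExt S.E f = 0 → S.IsProjTrivial f

/-- The map `f ↦ η(f^* -)`. -/
def contraForm {X T : C} (η : ExtOf S.E X T →ₗ[k] I) (Z : C) :
    (X ⟶ Z) →ₗ[k] (ExtOf S.E Z T →ₗ[k] I) where
  toFun f := η ∘ₗ pullExt S.E f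
  map_add' f g := by
    ext δ
    simp only [LinearMap.comp_apply, LinearMap.add_apply, ← map_add, S.pull_add]
  map_smul' r f := by
    ext δ
    simp only [LinearMap.comp_apply, LinearMap.smul_apply, ← map_smul, S.pull_smul,
      RingHom.id_apply]

/-- The map `g ↦ η(g_* -)`. -/
def covForm {X T : C} (η : ExtOf S.E X T →ₗ[k] I) (Z : C) :
    (Z ⟶ T) →ₗ[k] (ExtOf S.E X Z →ₗ[k] I) where
  toFun g := η ∘ₗ pushExt S.E g
  map_add' f g := by
    ext δ
    simp only [LinearMap.comp_apply, LinearMap.add_apply, ← map_add, S.push_add]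
  map_smul' r f := by
    ext δ
    simp only [LinearMap.comp_apply, LinearMap.smul_apply, ← map_smul, S.push_smul,
      RingHom.id_apply]

/-- A linear form which vanishes on the kernel of a linear map factors through that map. -/
lemma _root_.Module.Injective.exists_comp_eq [Module.Injective k I] {M N : Type v}
    [AddCommGroup M] [Module k M] [AddCommGroup N] [Module k N] (p : M →ₗ[k] N) (η : M →ₗ[k] I)
    (h : ∀ m, p m = 0 → η m = 0) : ∃ F : N →ₗ[k] I, F ∘ₗ p = η := by
  obtain ⟨F, hF⟩ := Module.Injective.out ((LinearMap.ker p).liftQ p le_rfl)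
    (LinearMap.ker_eq_bot.mp (Submodule.ker_liftQ_eq_bot' _ _ rfl))
    ((LinearMap.ker p).liftQ η fun m hm => h m hm)
  exact ⟨F, LinearMap.ext fun m => hF (Submodule.Quotient.mk m)⟩

variable {S} [IsArtinianRing k]

/-- Every form on `𝔼(X, W)` is some `η ∘ g_*`, and `η(g_* f^* ε) = η(f^* g_* ε)`; so if `η ∘ f^*`
vanishes, the cogenerator forces `f^* ε = 0`. For surjectivity, the forms `η ∘ f^*` need only
separate the points of `𝔼(Z, T)`. -/
lemma RepresentsCov.representsContra (hI : IsMinimalInjectiveCogenerator k I) (hn : 1 ≤ n)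
    (hS : S.IsExtFinite) {X T : C} {η : ExtOf S.E X T →ₗ[k] I} (h : S.RepresentsCov η) :
    S.RepresentsContra η where
  inj Z f hf W ε := by
    by_contra hne
    have := hS X W
    obtain ⟨F, hF⟩ := hI.cogenerator _ _ hne
    obtain ⟨g, rfl⟩ := h.surj W F
    apply hF
    rw [LinearMap.comp_apply, push_pull]
    exact LinearMap.congr_fun hf _
  surj Z F := by
    have := hS Z T
    have := hI.injective
    suffices LinearMap.range (S.contraForm η Z) = ⊤ by
      obtain ⟨f, hf⟩ := LinearMap.range_eq_top.mp this F
      exact ⟨f, hf⟩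
    refine hI.eq_top_of_separating _ fun δ hδ => ?_
    obtain ⟨R, hR⟩ := S.exists_realization δ
    -- By exactness the kernel of `(d_0)_*` consists of the elements `f^* δ`, on which `η` vanishes
    -- by assumption.
    obtain ⟨F, hF⟩ := Module.Injective.exists_comp_eq (pushExt S.E (B := X) R.dFirst) η
      fun ε hε => by
        obtain ⟨f, rfl⟩ := S.exists_pull_eq hn hR ε hε
        exact hδ _ ⟨f, rfl⟩
    obtain ⟨g, rfl⟩ := h.surj _ F
    -- From `η = η ∘ (d_0 g)_*` it follows that `𝟙 - d_0 g` is injectively trivial, hence `δ = g_*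
    -- (d_0)_* δ = 0`.
    have htriv := h.inj T (𝟙 T - R.dFirst ≫ g) (by
      ext ε
      rw [LinearMap.comp_apply, push_sub, push_id, push_comp, map_sub, LinearMap.zero_apply,
        sub_eq_zero]
      exact (LinearMap.congr_fun hF ε).symm)
    have := htriv Z δ
    rwa [push_sub, push_id, push_comp, S.push_dFirst hR, map_zero, sub_zero] at this

/-- The dual argument: `η` factors through pullback along the last differential of a realization,
and `𝟙 - f ≫ R.dLast` is projectively trivial. -/
lemma RepresentsContra.representsCov (hI : IsMinimalInjectiveCogenerator k I) (hn : 1 ≤ n)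
    (hS : S.IsExtFinite) {X T : C} {η : ExtOf S.E X T →ₗ[k] I} (h : S.RepresentsContra η) :
    S.RepresentsCov η where
  inj Z g hg W ε := by
    by_contra hne
    have := hS W T
    obtain ⟨F, hF⟩ := hI.cogenerator _ _ hne
    obtain ⟨f, rfl⟩ := h.surj W F
    apply hF
    rw [LinearMap.comp_apply, ← push_pull]
    exact LinearMap.congr_fun hg _
  surj Z F := by
    have := hS X Z
    have := hI.injective
    suffices LinearMap.range (S.covForm η Z) = ⊤ by
      obtain ⟨f, hf⟩ := LinearMap.range_eq_top.mp this F
      exact ⟨f, hf⟩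
    refine hI.eq_top_of_separating _ fun δ hδ => ?_
    obtain ⟨R, hR⟩ := S.exists_realization δ
    obtain ⟨F, hF⟩ := Module.Injective.exists_comp_eq (pullExt S.E (A := T) R.dLast) η
      fun ε hε => by
        obtain ⟨f, rfl⟩ := S.exists_push_eq hn hR ε hε
        exact hδ _ ⟨f, rfl⟩
    obtain ⟨f, rfl⟩ := h.surj _ F
    have htriv := h.inj X (𝟙 X - f ≫ R.dLast) (by
      ext ε
      rw [LinearMap.comp_apply, pull_sub, pull_id, pull_comp, map_sub, LinearMap.zero_apply,
        sub_eq_zero]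
      exact (LinearMap.congr_fun hF ε).symm)
    have := htriv Z δ
    rwa [pull_sub, pull_id, pull_comp, S.pull_dLast hR, map_zero, sub_zero] at this

end NExangulated
/-! ### Representing forms and representing objects -/

namespace NExangulated

variable {k : Type v} [CommRing k] {C : Type u} [Category.{v} C] [Preadditive C] [Linear k C]
  [HasBinaryBiproducts C] {n : ℕ} (S : NExangulated k C n)
  {I : Type v} [AddCommGroup I] [Module k I]

/-- The natural transformation `C̲(X, -) ⟶ D𝔼(-, T)` given by a form on `𝔼(X, T)`. -/
def coyonedaHom {X : S.Stable} {T : S.Costable} (η : ExtOf S.E X.as T.as →ₗ[k] I) :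
    (linearCoyoneda k S.Stable).obj (op X) ⟶ (S.DE I).flip.obj (op T) where
  app Z := ModuleCat.ofHom (Y := ((S.DE I).obj Z).obj (op T))
    { toFun := fun f : X ⟶ Z => (((S.DE I).map f).app (op T)).hom η
      map_add' := fun f g => by
        obtain ⟨f, rfl⟩ := (CategoryTheory.Quotient.functor S.projRel).map_surjective f
        obtain ⟨g, rfl⟩ := (CategoryTheory.Quotient.functor S.projRel).map_surjective g
        exact (S.contraForm η Z.as).map_add f g
      map_smul' := fun r f => by
        obtain ⟨f, rfl⟩ := (CategoryTheory.Quotient.functor S.projRel).map_surjective f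
        exact (S.contraForm η Z.as).map_smul r f }
  naturality Z W g := by
    ext f
    exact congrArg (fun a : (S.DE I).obj X ⟶ (S.DE I).obj W => (a.app (op T)).hom η)
      ((S.DE I).map_comp f g)

/-- The natural transformation `C̄(-, T) ⟶ D𝔼(X, -)` given by a form on `𝔼(X, T)`. -/
def yonedaHom {X : S.Stable} {T : S.Costable} (η : ExtOf S.E X.as T.as →ₗ[k] I) :
    (linearYoneda k S.Costable).obj T ⟶ (S.DE I).obj X where
  app Z := ModuleCat.ofHom (Y := ((S.DE I).obj X).obj Z)
    { toFun := fun g : Z.unop ⟶ T => (((S.DE I).obj X).map g.op).hom η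
      map_add' := fun f g => by
        obtain ⟨f, rfl⟩ := (CategoryTheory.Quotient.functor S.injRel).map_surjective f
        obtain ⟨g, rfl⟩ := (CategoryTheory.Quotient.functor S.injRel).map_surjective g
        exact (S.covForm η Z.unop.as).map_add f g
      map_smul' := fun r f => by
        obtain ⟨f, rfl⟩ := (CategoryTheory.Quotient.functor S.injRel).map_surjective f
        exact (S.covForm η Z.unop.as).map_smul r f }
  naturality Z W g := by
    ext f
    exact congrArg (fun a : ((S.DE I).obj X).obj (op T) ⟶ ((S.DE I).obj X).obj W => a.hom η)
      (((S.DE I).obj X).map_comp f.op g)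

variable {S}

lemma linearYoneda_hom_app_apply {X : S.Stable} {T Z : S.Costable}
    (φ : (linearYoneda k S.Costable).obj T ⟶ (S.DE I).obj X) (g : Z ⟶ T) :
    (φ.app (op Z)).hom g = (((S.DE I).obj X).map g.op).hom ((φ.app (op T)).hom (𝟙 T)) := by
  have := ConcreteCategory.congr_hom (φ.naturality g.op) (𝟙 T)
  refine Eq.trans ?_ this
  exact congrArg (φ.app (op Z)).hom (Category.comp_id g).symm

lemma linearCoyoneda_hom_app_apply {X Z : S.Stable} {T : S.Costable}
    (ψ : (linearCoyoneda k S.Stable).obj (op X) ⟶ (S.DE I).flip.obj (op T)) (f : X ⟶ Z) :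
    (ψ.app Z).hom f = (((S.DE I).map f).app (op T)).hom ((ψ.app X).hom (𝟙 X)) := by
  have := ConcreteCategory.congr_hom (ψ.naturality f) (𝟙 X)
  refine Eq.trans ?_ this
  exact congrArg (ψ.app Z).hom (Category.id_comp f).symm

end NExangulated
/-! ### The equivalence -/

namespace NExangulated

variable {k : Type v} [CommRing k] {C : Type u} [Category.{v} C] [Preadditive C] [Linear k C]
  [HasBinaryBiproducts C] {n : ℕ} {S : NExangulated k C n}
  {I : Type v} [AddCommGroup I] [Module k I]

/-- The form on `𝔼(X, T)` which corresponds to the identity of `T`. -/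
def covFormOf {X : S.Stable} {T : S.Costable}
    (φ : (linearYoneda k S.Costable).obj T ≅ (S.DE I).obj X) : ExtOf S.E X.as T.as →ₗ[k] I :=
  (φ.hom.app (op T)).hom (𝟙 T)

/-- The form on `𝔼(X, T)` which corresponds to the identity of `X`. -/
def contraFormOf {X : S.Stable} {T : S.Costable}
    (ψ : (linearCoyoneda k S.Stable).obj (op X) ≅ (S.DE I).flip.obj (op T)) :
    ExtOf S.E X.as T.as →ₗ[k] I :=
  (ψ.hom.app X).hom (𝟙 X)

lemma representsCov_covFormOf {X : S.Stable} {T : S.Costable}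
    (φ : (linearYoneda k S.Costable).obj T ≅ (S.DE I).obj X) :
    S.RepresentsCov (covFormOf φ) where
  surj Z F := by
    obtain ⟨g, hg⟩ := ((ConcreteCategory.isIso_iff_bijective
      (φ.hom.app (op ((CategoryTheory.Quotient.functor S.injRel).obj Z)))).mp inferInstance).2 F
    obtain ⟨g, rfl⟩ := (CategoryTheory.Quotient.functor S.injRel).map_surjective g
    exact ⟨g, (linearYoneda_hom_app_apply φ.hom _).symm.trans hg⟩
  inj Z g hg := by
    have hinj := ((ConcreteCategory.isIso_iff_bijective
      (φ.hom.app (op ((CategoryTheory.Quotient.functor S.injRel).obj Z)))).mp inferInstance).1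
    have h0 : (CategoryTheory.Quotient.functor S.injRel).map g =
        (CategoryTheory.Quotient.functor S.injRel).map 0 := by
      refine hinj ((linearYoneda_hom_app_apply φ.hom _).trans (Eq.trans hg ?_))
      exact (map_zero (φ.hom.app (op ((CategoryTheory.Quotient.functor S.injRel).obj Z))).hom).symm
    have := (CategoryTheory.Quotient.functor_map_eq_iff S.injRel g 0).mp h0
    rwa [injRel, sub_zero] at this

lemma representsContra_contraFormOf {X : S.Stable} {T : S.Costable}
    (ψ : (linearCoyoneda k S.Stable).obj (op X) ≅ (S.DE I).flip.obj (op T)) :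
    S.RepresentsContra (contraFormOf ψ) where
  surj Z F := by
    obtain ⟨f, hf⟩ := ((ConcreteCategory.isIso_iff_bijective
      (ψ.hom.app ((CategoryTheory.Quotient.functor S.projRel).obj Z))).mp inferInstance).2 F
    obtain ⟨f, rfl⟩ := (CategoryTheory.Quotient.functor S.projRel).map_surjective f
    exact ⟨f, (linearCoyoneda_hom_app_apply ψ.hom _).symm.trans hf⟩
  inj Z f hf := by
    have hinj := ((ConcreteCategory.isIso_iff_bijective
      (ψ.hom.app ((CategoryTheory.Quotient.functor S.projRel).obj Z))).mp inferInstance).1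
    have h0 : (CategoryTheory.Quotient.functor S.projRel).map f =
        (CategoryTheory.Quotient.functor S.projRel).map 0 := by
      refine hinj ((linearCoyoneda_hom_app_apply ψ.hom _).trans (Eq.trans hf ?_))
      exact (map_zero (ψ.hom.app ((CategoryTheory.Quotient.functor S.projRel).obj Z)).hom).symm
    have := (CategoryTheory.Quotient.functor_map_eq_iff S.projRel f 0).mp h0
    rwa [projRel, sub_zero] at this

lemma RepresentsCov.isIso_yonedaHom {X : S.Stable} {T : S.Costable}
    {η : ExtOf S.E X.as T.as →ₗ[k] I} (h : S.RepresentsCov η) : IsIso (S.yonedaHom η) := by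
  have : ∀ Z, IsIso ((S.yonedaHom η).app Z) := fun Z => by
    rw [ConcreteCategory.isIso_iff_bijective]
    constructor
    · refine (injective_iff_map_eq_zero ((S.yonedaHom η).app Z).hom).mpr fun g hg => ?_
      obtain ⟨g, rfl⟩ := (CategoryTheory.Quotient.functor S.injRel).map_surjective g
      refine ((CategoryTheory.Quotient.functor_map_eq_iff S.injRel g 0).mpr ?_)
      rw [injRel, sub_zero]
      exact h.inj _ g hg
    · intro F
      obtain ⟨g, hg⟩ := h.surj Z.unop.as F
      exact ⟨(CategoryTheory.Quotient.functor S.injRel).map g, hg⟩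
  exact NatIso.isIso_of_isIso_app _

lemma RepresentsContra.isIso_coyonedaHom {X : S.Stable} {T : S.Costable}
    {η : ExtOf S.E X.as T.as →ₗ[k] I} (h : S.RepresentsContra η) : IsIso (S.coyonedaHom η) := by
  have : ∀ Z, IsIso ((S.coyonedaHom η).app Z) := fun Z => by
    rw [ConcreteCategory.isIso_iff_bijective]
    constructor
    · refine (injective_iff_map_eq_zero ((S.coyonedaHom η).app Z).hom).mpr fun g hg => ?_
      obtain ⟨g, rfl⟩ := (CategoryTheory.Quotient.functor S.projRel).map_surjective g
      refine ((CategoryTheory.Quotient.functor_map_eq_iff S.projRel g 0).mpr ?_)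
      rw [projRel, sub_zero]
      exact h.inj _ g hg
    · intro F
      obtain ⟨g, hg⟩ := h.surj Z.as F
      exact ⟨(CategoryTheory.Quotient.functor S.projRel).map g, hg⟩
  exact NatIso.isIso_of_isIso_app _

/-! ### Naturality squares as identities between forms -/

lemma linearCoyoneda_hom_ext {X : S.Stable} {T : S.Costable}
    {α β : (linearCoyoneda k S.Stable).obj (op X) ⟶ (S.DE I).flip.obj (op T)}
    (h : (α.app X).hom (𝟙 X) = (β.app X).hom (𝟙 X)) : α = β := by
  ext Z f
  exact (linearCoyoneda_hom_app_apply α f).trans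
    ((congrArg _ h).trans (linearCoyoneda_hom_app_apply β f).symm)

lemma linearYoneda_hom_ext {X : S.Stable} {T : S.Costable}
    {α β : (linearYoneda k S.Costable).obj T ⟶ (S.DE I).obj X}
    (h : (α.app (op T)).hom (𝟙 T) = (β.app (op T)).hom (𝟙 T)) : α = β := by
  ext Z f
  exact (linearYoneda_hom_app_apply α f).trans
    ((congrArg _ h).trans (linearYoneda_hom_app_apply β f).symm)

lemma coyonedaHom_app_id {X : S.Stable} {T : S.Costable} (η : ExtOf S.E X.as T.as →ₗ[k] I) :
    ((S.coyonedaHom η).app X).hom (𝟙 X) = η :=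
  congrArg (fun a : (S.DE I).obj X ⟶ (S.DE I).obj X => (a.app (op T)).hom η) ((S.DE I).map_id X)

lemma yonedaHom_app_id {X : S.Stable} {T : S.Costable} (η : ExtOf S.E X.as T.as →ₗ[k] I) :
    ((S.yonedaHom η).app (op T)).hom (𝟙 T) = η :=
  congrArg (fun a : ((S.DE I).obj X).obj (op T) ⟶ ((S.DE I).obj X).obj (op T) => a.hom η)
    (((S.DE I).obj X).map_id (op T))

/-- Two forms `η` on `𝔼(X, T)` and `ζ` on `𝔼(M, U)` are compatible with `f : X ⟶ M` and
`g : T ⟶ U` if `η(f^* -) = ζ(g_* -)` on `𝔼(M, T)`. -/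
def Compatible {X M : S.Stable} {T U : S.Costable} (η : ExtOf S.E X.as T.as →ₗ[k] I)
    (ζ : ExtOf S.E M.as U.as →ₗ[k] I) (f : X ⟶ M) (g : T ⟶ U) : Prop :=
  (((S.DE I).map f).app (op T)).hom η = (((S.DE I).obj M).map g.op).hom ζ

/-- Both composites start at a representable functor, so they agree once they agree on `𝟙 T`; there
they give the two sides of `Compatible`. -/
lemma linearYoneda_square_iff {X M : S.Stable} {T U : S.Costable} (f : X ⟶ M) (g : T ⟶ U)
    (α : (linearYoneda k S.Costable).obj T ⟶ (S.DE I).obj X)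
    (β : (linearYoneda k S.Costable).obj U ⟶ (S.DE I).obj M) :
    (linearYoneda k S.Costable).map g ≫ β = α ≫ (S.DE I).map f ↔
      Compatible ((α.app (op T)).hom (𝟙 T)) ((β.app (op U)).hom (𝟙 U)) f g := by
  have hl : (((linearYoneda k S.Costable).map g ≫ β).app (op T)).hom (𝟙 T) =
      (((S.DE I).obj M).map g.op).hom ((β.app (op U)).hom (𝟙 U)) :=
    (congrArg (β.app (op T)).hom (Category.id_comp g)).trans (linearYoneda_hom_app_apply β g)
  constructor
  · intro h
    exact (congrArg (fun a : (linearYoneda k S.Costable).obj T ⟶ (S.DE I).obj M =>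
      (a.app (op T)).hom (𝟙 T)) h).symm.trans hl
  · intro h
    exact linearYoneda_hom_ext (hl.trans h.symm)

/-- The resulting condition is the same as in `linearYoneda_square_iff`; this is what ties `τ_n^-`
to `τ_n` on morphisms. -/
lemma linearCoyoneda_square_iff {X M : S.Stable} {T U : S.Costable} (f : X ⟶ M) (g : T ⟶ U)
    (α : (linearCoyoneda k S.Stable).obj (op X) ⟶ (S.DE I).flip.obj (op T))
    (β : (linearCoyoneda k S.Stable).obj (op M) ⟶ (S.DE I).flip.obj (op U)) :
    (linearCoyoneda k S.Stable).map f.op ≫ α = β ≫ (S.DE I).flip.map g.op ↔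
      Compatible ((α.app X).hom (𝟙 X)) ((β.app M).hom (𝟙 M)) f g := by
  have hl : (((linearCoyoneda k S.Stable).map f.op ≫ α).app M).hom (𝟙 M) =
      (((S.DE I).map f).app (op T)).hom ((α.app X).hom (𝟙 X)) :=
    (congrArg (α.app M).hom (Category.comp_id f)).trans (linearCoyoneda_hom_app_apply α f)
  constructor
  · intro h
    exact hl.symm.trans (congrArg (fun a : (linearCoyoneda k S.Stable).obj (op M) ⟶
      (S.DE I).flip.obj (op T) => (a.app M).hom (𝟙 M)) h)
  · intro h
    exact linearCoyoneda_hom_ext (hl.trans h)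

/-- Two objects representing the same `P` are canonically isomorphic, compatibly with lifts `f`,
`f'` of one `p`. For the two Yoneda embeddings, this makes the comparison isomorphisms natural. -/
lemma _root_.CategoryTheory.Functor.preimageIso_hom_naturality {D E : Type*} [Category* D]
    [Category* E] (F : D ⥤ E) [F.Full] [F.Faithful] {A A' B B' : D} {P Q : E}
    (α : F.obj A ≅ P) (α' : F.obj A' ≅ P) (β : F.obj B ≅ Q) (β' : F.obj B' ≅ Q) {f : A ⟶ B}
    {f' : A' ⟶ B'} {p : P ⟶ Q} (h : F.map f ≫ β.hom = α.hom ≫ p)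
    (h' : F.map f' ≫ β'.hom = α'.hom ≫ p) :
    f ≫ (F.preimageIso (β ≪≫ β'.symm)).hom = (F.preimageIso (α ≪≫ α'.symm)).hom ≫ f' := by
  apply F.map_injective
  simp only [Functor.map_comp, Functor.preimageIso_hom, Functor.map_preimage, Iso.trans_hom,
    Iso.symm_hom]
  rw [reassoc_of% h, Category.assoc, Iso.cancel_iso_hom_left, Iso.eq_inv_comp,
    ← Category.assoc, Iso.comp_inv_eq]
  exact h'.symm

lemma TauChoice.isTauMap_iff (t : S.TauChoice I) {X M : (S.Cr I).FullSubcategory} (f : X ⟶ M)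
    (g : t.obj X ⟶ t.obj M) : t.IsTauMap f g ↔ g = t.functor.map f :=
  ⟨fun h => (t.existsUnique_map f).choose_spec.2 g h, fun h =>
    h ▸ (t.existsUnique_map f).choose_spec.1⟩

lemma TauInvChoice.isTauInvMap_iff (t : S.TauInvChoice I) {Y N : (S.Cl I).FullSubcategory}
    (g : Y ⟶ N) (h : t.obj Y ⟶ t.obj N) : t.IsTauInvMap g h ↔ h = t.functor.map g :=
  ⟨fun h' => (t.existsUnique_map g).choose_spec.2 h h', fun h' =>
    h' ▸ (t.existsUnique_map g).choose_spec.1⟩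

variable [IsArtinianRing k]

/-- A representation of `D𝔼(X, -)` by `T` gives a representation of `D𝔼(-, T)` by `X`. -/
noncomputable def coyonedaIso (hI : IsMinimalInjectiveCogenerator k I) (hn : 1 ≤ n)
    (hS : S.IsExtFinite) {X : S.Stable} {T : S.Costable}
    (φ : (linearYoneda k S.Costable).obj T ≅ (S.DE I).obj X) :
    (linearCoyoneda k S.Stable).obj (op X) ≅ (S.DE I).flip.obj (op T) :=
  have := ((representsCov_covFormOf φ).representsContra hI hn hS).isIso_coyonedaHom
  asIso (S.coyonedaHom (covFormOf φ))

/-- A representation of `D𝔼(-, T)` by `X` gives a representation of `D𝔼(X, -)` by `T`. -/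
noncomputable def yonedaIso (hI : IsMinimalInjectiveCogenerator k I) (hn : 1 ≤ n)
    (hS : S.IsExtFinite) {X : S.Stable} {T : S.Costable}
    (ψ : (linearCoyoneda k S.Stable).obj (op X) ≅ (S.DE I).flip.obj (op T)) :
    (linearYoneda k S.Costable).obj T ≅ (S.DE I).obj X :=
  have := ((representsContra_contraFormOf ψ).representsCov hI hn hS).isIso_yonedaHom
  asIso (S.yonedaHom (contraFormOf ψ))

/-- `coyonedaIso` keeps the underlying form, and each of the two squares expresses compatibility of
the forms with `f` and `g`. -/
lemma coyonedaIso_square (hI : IsMinimalInjectiveCogenerator k I) (hn : 1 ≤ n)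
    (hS : S.IsExtFinite) {X M : S.Stable} {T U : S.Costable}
    (φ : (linearYoneda k S.Costable).obj T ≅ (S.DE I).obj X)
    (φ' : (linearYoneda k S.Costable).obj U ≅ (S.DE I).obj M) {f : X ⟶ M} {g : T ⟶ U}
    (h : (linearYoneda k S.Costable).map g ≫ φ'.hom = φ.hom ≫ (S.DE I).map f) :
    (linearCoyoneda k S.Stable).map f.op ≫ (coyonedaIso hI hn hS φ).hom =
      (coyonedaIso hI hn hS φ').hom ≫ (S.DE I).flip.map g.op := by
  refine (linearCoyoneda_square_iff f g _ _).mpr ?_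
  simp only [coyonedaIso, asIso_hom, coyonedaHom_app_id]
  exact (linearYoneda_square_iff f g _ _).mp h

lemma yonedaIso_square (hI : IsMinimalInjectiveCogenerator k I) (hn : 1 ≤ n)
    (hS : S.IsExtFinite) {X M : S.Stable} {T U : S.Costable}
    (ψ : (linearCoyoneda k S.Stable).obj (op X) ≅ (S.DE I).flip.obj (op T))
    (ψ' : (linearCoyoneda k S.Stable).obj (op M) ≅ (S.DE I).flip.obj (op U))
    {f : X ⟶ M} {g : T ⟶ U}
    (h : (linearCoyoneda k S.Stable).map f.op ≫ ψ.hom = ψ'.hom ≫ (S.DE I).flip.map g.op) :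
    (linearYoneda k S.Costable).map g ≫ (yonedaIso hI hn hS ψ').hom =
      (yonedaIso hI hn hS ψ).hom ≫ (S.DE I).map f := by
  refine (linearYoneda_square_iff f g _ _).mpr ?_
  simp only [yonedaIso, asIso_hom, yonedaHom_app_id]
  exact (linearCoyoneda_square_iff f g _ _).mp h

lemma TauChoice.cl_functor_obj (hI : IsMinimalInjectiveCogenerator k I) (hn : 1 ≤ n)
    (hS : S.IsExtFinite) (t : S.TauChoice I) (X : (S.Cr I).FullSubcategory) :
    S.Cl I (t.functor.obj X) :=
  ⟨X.obj, ⟨coyonedaIso hI hn hS (t.φ X)⟩⟩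

lemma TauInvChoice.cr_functor_obj (hI : IsMinimalInjectiveCogenerator k I) (hn : 1 ≤ n)
    (hS : S.IsExtFinite) (t : S.TauInvChoice I) (Y : (S.Cl I).FullSubcategory) :
    S.Cr I (t.functor.obj Y) :=
  ⟨Y.obj, ⟨yonedaIso hI hn hS (t.ψ Y)⟩⟩

/-- The isomorphism `τ_n^- τ_n X ≅ X`. -/
noncomputable def tauInvTauIsoApp (hI : IsMinimalInjectiveCogenerator k I) (hn : 1 ≤ n)
    (hS : S.IsExtFinite) (t : S.TauChoice I) (t' : S.TauInvChoice I)
    (X : (S.Cr I).FullSubcategory) :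
    t'.obj ⟨t.obj X, t.cl_functor_obj hI hn hS X⟩ ≅ X.obj :=
  -- Both `X` and `τ_n^- τ_n X` corepresent `D𝔼(-, τ_n X)`.
  ((linearCoyoneda k S.Stable).preimageIso
    (coyonedaIso hI hn hS (t.φ X) ≪≫ (t'.ψ ⟨t.obj X, t.cl_functor_obj hI hn hS X⟩).symm)).unop

/-- The isomorphism `τ_n τ_n^- Y ≅ Y`. -/
noncomputable def tauTauInvIsoApp (hI : IsMinimalInjectiveCogenerator k I) (hn : 1 ≤ n)
    (hS : S.IsExtFinite) (t : S.TauChoice I) (t' : S.TauInvChoice I)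
    (Y : (S.Cl I).FullSubcategory) :
    t.obj ⟨t'.obj Y, t'.cr_functor_obj hI hn hS Y⟩ ≅ Y.obj :=
  -- Both `Y` and `τ_n τ_n^- Y` represent `D𝔼(τ_n^- Y, -)`.
  (linearYoneda k S.Costable).preimageIso
    (t.φ ⟨t'.obj Y, t'.cr_functor_obj hI hn hS Y⟩ ≪≫ (yonedaIso hI hn hS (t'.ψ Y)).symm)

/-- The isomorphism `τ_n^- τ_n ≅ Id`. -/
noncomputable def tauInvTauIso (hI : IsMinimalInjectiveCogenerator k I) (hn : 1 ≤ n)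
    (hS : S.IsExtFinite) (t : S.TauChoice I) (t' : S.TauInvChoice I) :
    (S.Cl I).lift t.functor (t.cl_functor_obj hI hn hS) ⋙
      (S.Cr I).lift t'.functor (t'.cr_functor_obj hI hn hS) ≅ 𝟭 _ :=
  NatIso.ofComponents
    (fun X => (S.Cr I).isoMk (tauInvTauIsoApp hI hn hS t t' X)) fun {X M} f => by
      apply ObjectProperty.hom_ext
      have h₁ := coyonedaIso_square hI hn hS _ _ ((t.isTauMap_iff f _).mpr rfl)
      have h₂ := (t'.isTauInvMap_iff
        (((S.Cl I).lift t.functor (t.cl_functor_obj hI hn hS)).map f) _).mpr rfl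
      -- The coyoneda embedding is contravariant, so the comparison square lives in the opposite
      -- category and is read backwards.
      apply Quiver.Hom.op_inj
      exact ((linearCoyoneda k S.Stable).preimageIso_hom_naturality _ _ _ _ h₁ h₂).symm

/-- The isomorphism `τ_n τ_n^- ≅ Id`. -/
noncomputable def tauTauInvIso (hI : IsMinimalInjectiveCogenerator k I) (hn : 1 ≤ n)
    (hS : S.IsExtFinite) (t : S.TauChoice I) (t' : S.TauInvChoice I) :
    (S.Cr I).lift t'.functor (t'.cr_functor_obj hI hn hS) ⋙
      (S.Cl I).lift t.functor (t.cl_functor_obj hI hn hS) ≅ 𝟭 _ :=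
  NatIso.ofComponents
    (fun Y => (S.Cl I).isoMk (tauTauInvIsoApp hI hn hS t t' Y)) fun {Y N} g => by
      apply ObjectProperty.hom_ext
      have h₁ := yonedaIso_square hI hn hS _ _ ((t'.isTauInvMap_iff g _).mpr rfl)
      have h₂ := (t.isTauMap_iff
        (((S.Cr I).lift t'.functor (t'.cr_functor_obj hI hn hS)).map g) _).mpr rfl
      exact (linearYoneda k S.Costable).preimageIso_hom_naturality _ _ _ _ h₂ h₁

end NExangulated

theorem theorem3p10 {k : Type v} [CommRing k] [IsArtinianRing k]
    {I : Type v} [AddCommGroup I] [Module k I] (hI : IsMinimalInjectiveCogenerator k I)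
    {C : Type u} [Category.{v} C] [Preadditive C] [Linear k C] [HasZeroObject C]
    [HasBinaryBiproducts C] (hC : IsKrullSchmidt C) {n : ℕ} (hn : 1 ≤ n)
    (S : NExangulated k C n) (hS : S.IsExtFinite)
    (t : S.TauChoice I) (t' : S.TauInvChoice I) :
    (∀ {X M : (S.Cr I).FullSubcategory} (f : X ⟶ M) (g : t.obj X ⟶ t.obj M),
      t.IsTauMap f g ↔ g = t.functor.map f) ∧
    (∀ {Y N : (S.Cl I).FullSubcategory} (g : Y ⟶ N) (h : t'.obj Y ⟶ t'.obj N),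
      t'.IsTauInvMap g h ↔ h = t'.functor.map g) ∧
    ∃ (hl : ∀ X, S.Cl I (t.functor.obj X)) (hr : ∀ Y, S.Cr I (t'.functor.obj Y)),
      ((S.Cl I).lift t.functor hl).IsEquivalence ∧
      ((S.Cr I).lift t'.functor hr).IsEquivalence ∧
      Nonempty ((S.Cl I).lift t.functor hl ⋙ (S.Cr I).lift t'.functor hr ≅ 𝟭 _) ∧
      Nonempty ((S.Cr I).lift t'.functor hr ⋙ (S.Cl I).lift t.functor hl ≅ 𝟭 _) := by
  let e := CategoryTheory.Equivalence.mk _ _ (S.tauInvTauIso hI hn hS t t').symm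
    (S.tauTauInvIso hI hn hS t t')
  exact ⟨t.isTauMap_iff, t'.isTauInvMap_iff, t.cl_functor_obj hI hn hS,
    t'.cr_functor_obj hI hn hS, e.isEquivalence_functor, e.isEquivalence_inverse,
    ⟨NExangulated.tauInvTauIso hI hn hS t t'⟩, ⟨NExangulated.tauTauInvIso hI hn hS t t'⟩⟩
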